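/- Let $\mathbb F$ be an algebraically closed field of characteristic zero, let $q\in\mathbb F\setminus\{0\}$ be not a root of unity, and let $E=\overline{\mathbb F(x)}$ be the algebraic closure of $\mathbb F(x)$. Let $\tau_x$ be any extension to $E$ of the $\mathbb F$-automorphism $x\mapsto qx$ of $\mathbb F(x)$, extended further to $E(y)$ by $\tau_x(y)=y$, and let $\tau_y$ be the $E$-automorphism of $E(y)$ with $\tau_y(y)=qy$. Call $f\in E(y)$ $(\tau_x,\tau_y)$-summable in $E(y)$ if $f=\tau_x(g)-g+\tau_y(h)-h$ for some $g,h\in E(y)$. Let $j\ge 1$ be an integer and $$f=\sum_{i=1}^m\frac{\alpha_i}{(y-\beta_i)^j},\qquad \alpha_i,\beta_i\in E\setminus\{0\},$$ where for all $1\le i<i'\le m$ and all $n\in\mathbb Z$ we have $\beta_i/\tau_x^n(\beta_{i'})\notin q^{\mathbb Z}$. (a) $f$ is $(\tau_x,\tau_y)$-summable in $E(y)$ if and only if for each $i\in\{1,\dots,m\}$ there are $s_i\in\mathbb Z$, $t_i\in\mathbb N\setminus\{0\}$, $c_i\in\mathbb F$ and $\gamma_i\in E$ such that $$\beta_i=c_i\,x^{s_i/t_i}\quad\text{and}\quad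 \alpha_i=q^{-js_i}\,\tau_x^{t_i}(\gamma_i)-\gamma_i,$$ where $x^{s_i/t_i}=(x^{1/t_i})^{s_i}$ and $x^{1/t_i}\in E$ is a $t_i$-th root of $x$. (b) Suppose moreover that $\alpha_i\in\mathbb F(x)(\beta_i)$ for every $i$ (as is the case for the coefficients that come from a rational function in $\mathbb F(x,y)$). Then $f$ is $(\tau_x,\tau_y)$-summable in $E(y)$ if and only if for each $i\in\{1,\dots,m\}$ there are $s_i\in\mathbb Z$, $t_i\in\mathbb N\setminus\{0\}$, $c_i\in\mathbb F$ and $\gamma_i\in\mathbb F(x^{1/t_i})$ such that $\beta_i=c_i\,x^{s_i/t_i}$ and $\alpha_i=q^{-js_i}\,\tau_x^{t_i}(\gamma_i)-\gamma_i$. -/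

import Mathlib

noncomputable section

namespace QSummability

/-- The algebraic closure of the rational function field `F(x)`. -/
abbrev AlgFun (F : Type*) [Field F] : Type _ := AlgebraicClosure (RatFunc F)

/-- The variable `x`, as an element of the algebraic closure of `F(x)`. -/
def xvar (F : Type*) [Field F] : AlgFun F :=
  algebraMap (RatFunc F) (AlgFun F) RatFunc.X

/-- `τ` is an extension, to the algebraic closure of `F(x)`, of the `F`-automorphism
`f(x) ↦ f(qx)` of `F(x)`. (An `F`-automorphism is determined on `F(x)` by the image of `x`.) -/
def IsQShift {F : Type*} [Field F] (q : F) (τ : AlgFun F ≃ₐ[F] AlgFun F) : Prop :=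
  τ (xvar F) = algebraMap F (AlgFun F) q * xvar F

/-- The automorphism of `E(y)` that applies `σ` to the coefficients and fixes `y`. -/
def coeffAut {E : Type*} [Field E] (σ : E ≃+* E) : RatFunc E ≃+* RatFunc E :=
  IsFractionRing.ringEquivOfRingEquiv (Polynomial.mapEquiv σ)

/-- The automorphism of `E(y)` that fixes `E` and maps `y` to `q y`, for `q ≠ 0`. -/
def scaleAut {E : Type*} [Field E] (q : E) (hq : q ≠ 0) : RatFunc E ≃+* RatFunc E :=
  haveI : Invertible q := invertibleOfNonzero hq
  IsFractionRing.ringEquivOfRingEquiv (Polynomial.algEquivCMulXAddC q 0).toRingEquiv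

/-- `τ_x` on `E(y)`, for `E` the algebraic closure of `F(x)`: it acts on `E` as `τ` and fixes `y`. -/
def tauX {F : Type*} [Field F] (τ : AlgFun F ≃ₐ[F] AlgFun F) :
    RatFunc (AlgFun F) ≃+* RatFunc (AlgFun F) :=
  coeffAut τ.toRingEquiv

/-- `τ_y` on `E(y)`, for `E` the algebraic closure of `F(x)`: it fixes `E` and maps `y` to `q y`. -/
def tauY {F : Type*} [Field F] (q : F) (hq : q ≠ 0) :
    RatFunc (AlgFun F) ≃+* RatFunc (AlgFun F) :=
  scaleAut (algebraMap F (AlgFun F) q)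
    ((map_ne_zero_iff _ (algebraMap F (AlgFun F)).injective).mpr hq)

/-- `f` is `(φ, ψ)`-summable in the field `K`: `f = φ(g) - g + ψ(h) - h` with `g, h ∈ K`. -/
def IsSummable {K : Type*} [Field K] (φ ψ : K ≃+* K) (f : K) : Prop :=
  ∃ g h : K, f = (φ g - g) + (ψ h - h)

theorem coeffAut_C {E : Type*} [Field E] (σ : E ≃+* E) (a : E) :
    coeffAut σ (RatFunc.C a) = RatFunc.C (σ a) := by
  rw [← RatFunc.algebraMap_C, ← RatFunc.algebraMap_C, coeffAut,
    IsFractionRing.ringEquivOfRingEquiv_algebraMap]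
  simp

theorem coeffAut_X {E : Type*} [Field E] (σ : E ≃+* E) :
    coeffAut σ (RatFunc.X : RatFunc E) = RatFunc.X := by
  rw [← RatFunc.algebraMap_X, coeffAut, IsFractionRing.ringEquivOfRingEquiv_algebraMap]
  simp

theorem scaleAut_C {E : Type*} [Field E] (q : E) (hq : q ≠ 0) (a : E) :
    scaleAut q hq (RatFunc.C a) = RatFunc.C a := by
  rw [← RatFunc.algebraMap_C, scaleAut, IsFractionRing.ringEquivOfRingEquiv_algebraMap]
  simp

theorem scaleAut_X {E : Type*} [Field E] (q : E) (hq : q ≠ 0) :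
    scaleAut q hq (RatFunc.X : RatFunc E) = RatFunc.C q * RatFunc.X := by
  rw [← RatFunc.algebraMap_X, scaleAut, IsFractionRing.ringEquivOfRingEquiv_algebraMap]
  simp

end QSummability

end

open QSummability

noncomputable section

namespace QSummability

/-! Write `Q` for the image of `q` in `E`. The invariant is the residue along a `q`-orbit, `Res_b(f)
= ∑ₖ Q^(-jk) cₖ`, where `cₖ` is the coefficient of `(y - Q^k b)^(-j)` in `f`. It is unchanged by
`τ_y`, it satisfies `Res_{τ b}(τ_x f) = τ (Res_b f)`, and replacing `b` by `Q^s b` multiplies it by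
`Q^(js)`. So if `f = τ_x g - g + τ_y h - h` and `R n` is the residue of `g` at `τ^n b`, then the
residue of `f` at `τ^(n+1) b` is `τ (R n) - R (n+1)`.

Take `b = β i`. By the orbit condition the residue of `f` at `b` is `α i`, and it vanishes at every
`τ^n b` outside the `q`-orbit of `b`. If some positive power of `τ` returns `b` to its `q`-orbit,
the first return `τ^t b = Q^s b` closes the recursion and gives `α i = Q^(-js) τ^t γ - γ` with `γ =
R 0`. Otherwise the recursion makes infinitely many `R n` nonzero, although `g` has finitely many
poles (`exists_twisted_difference_of_isSummable`). A relation `τ^t b = Q^s b` makes `b / ξ^s` fixed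
by `τ^t` when `ξ^t = x`, and fixed elements are constants (`exists_eq_algebraMap_of_fixed`).

Conversely, moving the pole `γ / (y - b)^j` once around its closed orbit changes it only by summable
terms. For (b), a normalized trace brings `γ` down to `F(ξ)`. -/

open Polynomial in
/-- Induction on rational functions over an algebraically closed field through their partial
fraction decomposition. -/
theorem ratFunc_induction_partialFractions {K : Type*} [Field K] [IsAlgClosed K]
    {P : RatFunc K → Prop} (poly : ∀ p : K[X], P (algebraMap K[X] (RatFunc K) p))
    (pole : ∀ (a b : K) (n : ℕ), P (RatFunc.C a / (RatFunc.X - RatFunc.C b) ^ (n + 1)))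
    (add : ∀ f g, P f → P g → P (f + g)) (f : RatFunc K) : P f := by
  classical
  have sum : ∀ {ι : Type _} (s : Finset ι) (u : ι → RatFunc K), (∀ i ∈ s, P (u i)) →
      P (∑ i ∈ s, u i) := by
    intro ι s u hu
    induction s using Finset.cons_induction with
    | empty => simpa using poly 0
    | cons i s hi ih =>
      rw [Finset.sum_cons]
      exact add _ _ (hu i (by simp)) (ih fun k hk => hu k (by simp [hk]))
  have sum' : ∀ {m : ℕ} (u : Fin m → RatFunc K), (∀ i, P (u i)) → P (∑ i, u i) := by
    intro m u hu
    induction m with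
    | zero => simpa using poly 0
    | succ m ih =>
      rw [Fin.sum_univ_succ]
      exact add _ _ (hu 0) (ih _ fun k => hu _)
  set d := f.denom with hd
  have hroots : d = ∏ b ∈ d.roots.toFinset, (X - C b) ^ d.roots.count b := by
    conv_lhs => rw [(IsAlgClosed.splits d).eq_prod_roots_of_monic f.monic_denom]
    rw [Finset.prod_multiset_map_count]
  have hgi : ∀ b ∈ d.roots.toFinset, (algebraMap K[X] (RatFunc K) (X - C b))⁻¹ *
      algebraMap K[X] (RatFunc K) (X - C b) = 1 := fun b _ =>
    inv_mul_cancel₀ (RatFunc.algebraMap_ne_zero (X_sub_C_ne_zero b))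
  obtain ⟨p, r, hr, h⟩ := mul_prod_pow_inverse_eq_quo_add_sum_rem_mul_pow_inverse
    (s := d.roots.toFinset) (g := fun b : K => X - C b) f.num (fun b _ => monic_X_sub_C b)
    (fun b _ c _ hbc => pairwise_coprime_X_sub_C Function.injective_id hbc)
    (fun b => d.roots.count b) hgi
  have hf : f = algebraMap K[X] (RatFunc K) f.num *
      ∏ b ∈ d.roots.toFinset, (algebraMap K[X] (RatFunc K) (X - C b))⁻¹ ^ d.roots.count b := by
    conv_lhs => rw [← RatFunc.num_div_denom f, ← hd, hroots]
    simp [div_eq_mul_inv]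
  rw [hf, h]
  refine add _ _ (poly p) (sum _ _ fun b hb => sum' _ fun i => ?_)
  have h0 : (r b i).degree ≤ 0 :=
    Nat.WithBot.lt_one_iff_le_zero.mp (degree_X_sub_C b ▸ hr b hb i)
  rw [eq_C_of_degree_le_zero h0]
  simpa [div_eq_mul_inv] using pole ((r b i).coeff 0) b i

/-! ### Polar coefficients from Laurent expansions -/

section Laurent

variable {K : Type*} [Field K]

theorem powerSeriesTaylor_injective (b : K) : Function.Injective
    ((HahnSeries.ofPowerSeries ℤ K).comp
      ((Polynomial.coeToPowerSeries.ringHom (R := K)).comp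
        (Polynomial.taylorAlgHom b : Polynomial K →+* Polynomial K))) := by
  intro p p' h
  exact Polynomial.taylor_injective b
    (Polynomial.coe_injective K (HahnSeries.ofPowerSeries_injective h))

/-- The Laurent expansion of a rational function at `b`. -/
def laurentAt (b : K) : RatFunc K →+* LaurentSeries K :=
  RatFunc.liftRingHom
    ((HahnSeries.ofPowerSeries ℤ K).comp
      ((Polynomial.coeToPowerSeries.ringHom (R := K)).comp
        (Polynomial.taylorAlgHom b : Polynomial K →+* Polynomial K)))
    (nonZeroDivisors_le_comap_nonZeroDivisors_of_injective _ (powerSeriesTaylor_injective b))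

theorem laurentAt_polynomial (b : K) (p : Polynomial K) :
    laurentAt b (algebraMap _ _ p) =
      HahnSeries.ofPowerSeries ℤ K (Polynomial.taylor b p : Polynomial K) :=
  RatFunc.liftRingHom_algebraMap _ _ _

/-- The coefficient of `(y - b) ^ (-j)` in the Laurent expansion of a rational function at `b`. -/
def polarCoeff (j : ℕ) (b : K) : RatFunc K →+ K where
  toFun f := (laurentAt b f).coeff (-j : ℤ)
  map_zero' := by simp
  map_add' := by simp

theorem polarCoeff_apply (j : ℕ) (b : K) (f : RatFunc K) :
    polarCoeff j b f = (laurentAt b f).coeff (-j : ℤ) := rfl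

variable {j : ℕ}

/-- A power series has no terms of negative degree, and `1 ≤ j` makes `-j` negative. -/
theorem polarCoeff_eq_zero_of_laurentAt (hj : 1 ≤ j) {b : K} {f : RatFunc K} (u : PowerSeries K)
    (h : laurentAt b f = HahnSeries.ofPowerSeries ℤ K u) : polarCoeff j b f = 0 := by
  rw [polarCoeff_apply, h, PowerSeries.coeff_coe, if_pos (by omega)]

theorem polarCoeff_polynomial (hj : 1 ≤ j) (b : K) (p : Polynomial K) :
    polarCoeff j b (algebraMap _ _ p) = 0 :=
  polarCoeff_eq_zero_of_laurentAt hj _ (laurentAt_polynomial b p)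

theorem laurentAt_C (b a : K) :
    laurentAt b (RatFunc.C a) = HahnSeries.ofPowerSeries ℤ K (PowerSeries.C a) := by
  rw [← RatFunc.algebraMap_C, laurentAt_polynomial]
  simp

theorem laurentAt_X_sub_C (b c : K) : laurentAt b (RatFunc.X - RatFunc.C c) =
    HahnSeries.ofPowerSeries ℤ K (PowerSeries.X + PowerSeries.C (b - c)) := by
  rw [← RatFunc.algebraMap_C, ← RatFunc.algebraMap_X, ← map_sub, laurentAt_polynomial]
  congr 1
  simp [add_sub_assoc]

theorem polarCoeff_pole_of_ne (hj : 1 ≤ j) {b c : K} (h : b ≠ c) (a : K) (n : ℕ) :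
    polarCoeff j b (RatFunc.C a / (RatFunc.X - RatFunc.C c) ^ n) = 0 := by
  have hu : PowerSeries.constantCoeff (PowerSeries.X + PowerSeries.C (b - c)) ≠ 0 := by
    simpa using sub_ne_zero.mpr h
  refine polarCoeff_eq_zero_of_laurentAt hj
    (PowerSeries.C a * (PowerSeries.X + PowerSeries.C (b - c))⁻¹ ^ n) ?_
  have hne : laurentAt b (RatFunc.X - RatFunc.C c) ≠ 0 := by
    rw [laurentAt_X_sub_C]
    refine (map_ne_zero_iff _ HahnSeries.ofPowerSeries_injective).mpr fun h0 => hu ?_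
    rw [h0, map_zero]
  rw [map_div₀, map_pow, laurentAt_C, div_eq_iff (pow_ne_zero _ hne), laurentAt_X_sub_C,
    ← map_pow, ← map_mul, mul_assoc, ← mul_pow, PowerSeries.inv_mul_cancel _ hu, one_pow, mul_one]

theorem polarCoeff_pole_self (b a : K) (n : ℕ) :
    polarCoeff j b (RatFunc.C a / (RatFunc.X - RatFunc.C b) ^ n) = if n = j then a else 0 := by
  have h : laurentAt b (RatFunc.C a / (RatFunc.X - RatFunc.C b) ^ n) =
      HahnSeries.single (-n : ℤ) a := by
    rw [map_div₀, map_pow, laurentAt_C, laurentAt_X_sub_C]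
    simp [div_eq_mul_inv]
  rw [polarCoeff_apply, h, HahnSeries.coeff_single]
  simp [eq_comm]

theorem polarCoeff_pole [DecidableEq K] (hj : 1 ≤ j) (b a c : K) (n : ℕ) :
    polarCoeff j b (RatFunc.C a / (RatFunc.X - RatFunc.C c) ^ n) =
      if c = b ∧ n = j then a else 0 := by
  by_cases h : c = b
  · subst h
    simp [polarCoeff_pole_self]
  · simp [h, polarCoeff_pole_of_ne hj (Ne.symm h)]

theorem scaleAut_pole (q : K) (hq : q ≠ 0) (a c : K) (n : ℕ) :
    scaleAut q hq (RatFunc.C a / (RatFunc.X - RatFunc.C c) ^ n) =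
      RatFunc.C ((q ^ n)⁻¹ * a) / (RatFunc.X - RatFunc.C (q⁻¹ * c)) ^ n := by
  have : RatFunc.C q * RatFunc.X - RatFunc.C c =
      RatFunc.C q * (RatFunc.X - RatFunc.C (q⁻¹ * c)) := by
    rw [mul_sub, ← map_mul, mul_inv_cancel_left₀ hq]
  rw [map_div₀, map_pow, map_sub, scaleAut_C, scaleAut_C, scaleAut_X, this, mul_pow,
    map_mul RatFunc.C _ a, map_inv₀, map_pow, ← div_div,
    inv_mul_eq_div (RatFunc.C q ^ n)]

end Laurent

/-! ### Polar coefficients under the two automorphisms -/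

section Equivariance

variable {K : Type*} [Field K] [IsAlgClosed K] {j : ℕ}

theorem finite_polarCoeff_ne_zero (hj : 1 ≤ j) (f : RatFunc K) :
    {b : K | polarCoeff j b f ≠ 0}.Finite := by
  classical
  induction f using ratFunc_induction_partialFractions with
  | poly p => simp [polarCoeff_polynomial hj]
  | pole a c n =>
    refine (Set.finite_singleton c).subset fun b hb => ?_
    by_contra h
    exact hb (polarCoeff_pole_of_ne hj h a _)
  | add f g hf hg =>
    refine (hf.union hg).subset fun b hb => ?_
    by_contra h
    simp only [Set.mem_union, Set.mem_ofPred_eq, not_or, not_not] at h hb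
    exact hb (by rw [map_add, h.1, h.2, add_zero])

theorem polarCoeff_coeffAut (hj : 1 ≤ j) (σ : K ≃+* K) (b : K) (f : RatFunc K) :
    polarCoeff j (σ b) (coeffAut σ f) = σ (polarCoeff j b f) := by
  classical
  induction f using ratFunc_induction_partialFractions with
  | poly p =>
    rw [coeffAut, IsFractionRing.ringEquivOfRingEquiv_algebraMap, polarCoeff_polynomial hj,
      polarCoeff_polynomial hj, map_zero]
  | pole a c n =>
    rw [map_div₀, map_pow, map_sub, coeffAut_C, coeffAut_C, coeffAut_X, polarCoeff_pole hj,
      polarCoeff_pole hj]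
    simp [apply_ite σ]
  | add f g hf hg => simp only [map_add, hf, hg]

theorem polarCoeff_scaleAut (hj : 1 ≤ j) (q : K) (hq : q ≠ 0) (b : K) (f : RatFunc K) :
    polarCoeff j b (scaleAut q hq f) = (q ^ j)⁻¹ * polarCoeff j (q * b) f := by
  classical
  induction f using ratFunc_induction_partialFractions with
  | poly p =>
    rw [scaleAut, IsFractionRing.ringEquivOfRingEquiv_algebraMap, polarCoeff_polynomial hj,
      polarCoeff_polynomial hj, mul_zero]
  | pole a c n =>
    rw [scaleAut_pole, polarCoeff_pole hj, polarCoeff_pole hj, mul_ite, mul_zero,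
      inv_mul_eq_iff_eq_mul₀ hq]
    split_ifs with h
    · rw [h.2]
    · rfl
  | add f g hf hg => simp only [map_add, hf, hg, mul_add]

end Equivariance

/-! ### Residues along `q`-orbits -/

section QResidue

variable {K : Type*} [Field K]

/-- The discrete residue of `f` of multiplicity `j` at the `q`-orbit of `b`. -/
def qResidue (q : K) (j : ℕ) (b : K) (f : RatFunc K) : K :=
  ∑ᶠ k : ℤ, q ^ (-(j * k : ℤ)) * polarCoeff j (q ^ k * b) f

variable {q : K} {j : ℕ} {b : K}

theorem zpow_injective_of_pow_ne_one (hq0 : q ≠ 0) (hq : ∀ n : ℕ, 0 < n → q ^ n ≠ 1) :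
    Function.Injective fun k : ℤ => q ^ k := by
  have key : ∀ a b : ℤ, a < b → q ^ a ≠ q ^ b := by
    intro a b hab h
    obtain ⟨n, hn⟩ := Int.eq_ofNat_of_zero_le (sub_nonneg.mpr hab.le)
    refine hq n (by omega) ?_
    rw [← zpow_natCast, ← hn, zpow_sub₀ hq0, h, div_self (zpow_ne_zero _ hq0)]
  intro a b h
  rcases lt_trichotomy a b with h' | h' | h'
  · exact absurd h (key a b h')
  · exact h'
  · exact absurd h.symm (key b a h')

theorem qResidue_zpow_mul (hq0 : q ≠ 0) (s : ℤ) (b : K) (f : RatFunc K) :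
    qResidue q j (q ^ s * b) f = q ^ (j * s : ℤ) * qResidue q j b f := by
  rw [qResidue, qResidue, ← smul_eq_mul (q ^ (j * s : ℤ)), smul_finsum]
  refine Eq.trans (finsum_congr fun k => ?_) (finsum_comp_equiv (Equiv.addRight s)
    (f := fun k : ℤ => q ^ (j * s : ℤ) • (q ^ (-(j * k : ℤ)) * polarCoeff j (q ^ k * b) f)))
  simp only [Equiv.coe_addRight]
  rw [smul_eq_mul, ← mul_assoc, ← mul_assoc, ← zpow_add₀ hq0,
    ← zpow_add₀ hq0]
  congr 2
  ring

theorem qResidue_pole_of_ne (hj : 1 ≤ j) {a c : K} (h : ∀ k : ℤ, q ^ k * b ≠ c) :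
    qResidue q j b (RatFunc.C a / (RatFunc.X - RatFunc.C c) ^ j) = 0 := by
  rw [qResidue, ← finsum_zero (α := ℤ)]
  exact finsum_congr fun k => by rw [polarCoeff_pole_of_ne hj (h k), mul_zero]

theorem qResidue_pole_self (hj : 1 ≤ j) (hq0 : q ≠ 0) (hq : ∀ n : ℕ, 0 < n → q ^ n ≠ 1)
    (hb : b ≠ 0) (a : K) :
    qResidue q j b (RatFunc.C a / (RatFunc.X - RatFunc.C b) ^ j) = a := by
  rw [qResidue, finsum_eq_single _ (0 : ℤ)]
  · simp [polarCoeff_pole_self]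
  · intro k hk
    rw [polarCoeff_pole_of_ne hj, mul_zero]
    intro h
    refine hk (zpow_injective_of_pow_ne_one hq0 hq ?_)
    exact mul_right_cancel₀ hb (by simpa using h)

variable [IsAlgClosed K]

/-- For `b ≠ 0` the points `q ^ k * b` are distinct, so finitely many are poles. This makes the
`finsum` a genuine sum, as additivity requires; an infinite support would give the default value
`0`. -/
theorem finite_support_qResidue (hj : 1 ≤ j) (hq0 : q ≠ 0) (hq : ∀ n : ℕ, 0 < n → q ^ n ≠ 1)
    (hb : b ≠ 0) (f : RatFunc K) :
    (Function.support fun k : ℤ => q ^ (-(j * k : ℤ)) * polarCoeff j (q ^ k * b) f).Finite := by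
  refine ((finite_polarCoeff_ne_zero hj f).preimage
    (f := fun k : ℤ => q ^ k * b) ?_).subset fun k hk => right_ne_zero_of_mul hk
  exact ((mul_left_injective₀ hb).comp (zpow_injective_of_pow_ne_one hq0 hq)).injOn

theorem qResidue_add (hj : 1 ≤ j) (hq0 : q ≠ 0) (hq : ∀ n : ℕ, 0 < n → q ^ n ≠ 1)
    (hb : b ≠ 0) (f g : RatFunc K) :
    qResidue q j b (f + g) = qResidue q j b f + qResidue q j b g := by
  simp only [qResidue, map_add, mul_add]
  exact finsum_add_distrib (finite_support_qResidue hj hq0 hq hb f)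
    (finite_support_qResidue hj hq0 hq hb g)

theorem qResidue_sub (hj : 1 ≤ j) (hq0 : q ≠ 0) (hq : ∀ n : ℕ, 0 < n → q ^ n ≠ 1)
    (hb : b ≠ 0) (f g : RatFunc K) :
    qResidue q j b (f - g) = qResidue q j b f - qResidue q j b g := by
  rw [eq_sub_iff_add_eq, ← qResidue_add hj hq0 hq hb, sub_add_cancel]

theorem qResidue_sum (hj : 1 ≤ j) (hq0 : q ≠ 0) (hq : ∀ n : ℕ, 0 < n → q ^ n ≠ 1)
    (hb : b ≠ 0) {ι : Type*} (s : Finset ι) (u : ι → RatFunc K) :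
    qResidue q j b (∑ i ∈ s, u i) = ∑ i ∈ s, qResidue q j b (u i) := by
  classical
  induction s using Finset.induction_on with
  | empty => simp [qResidue]
  | insert i s hi ih => rw [Finset.sum_insert hi, Finset.sum_insert hi, qResidue_add hj hq0 hq hb, ih]

/-- The weights in `qResidue` are chosen for this: the shift `k ↦ k + 1` absorbs the factor `q ^
(-j)` that scaling produces. -/
theorem qResidue_scaleAut (hj : 1 ≤ j) (hq0 : q ≠ 0) (b : K) (f : RatFunc K) :
    qResidue q j b (scaleAut q hq0 f) = qResidue q j b f := by
  refine Eq.trans (finsum_congr fun k => ?_) (finsum_comp_equiv (Equiv.addRight (1 : ℤ))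
    (f := fun k : ℤ => q ^ (-(j * k : ℤ)) * polarCoeff j (q ^ k * b) f))
  simp only [Equiv.coe_addRight]
  rw [polarCoeff_scaleAut hj, ← mul_assoc, ← mul_assoc,
    ← zpow_one_add₀ hq0 k, add_comm 1 k, ← zpow_natCast, ← zpow_neg, ← zpow_add₀ hq0]
  congr 2
  ring

theorem qResidue_coeffAut (hj : 1 ≤ j) (σ : K ≃+* K) (hσ : σ q = q) (b : K) (f : RatFunc K) :
    qResidue q j (σ b) (coeffAut σ f) = σ (qResidue q j b f) := by
  rw [qResidue, qResidue, ← RingEquiv.coe_toAddEquiv, AddEquiv.map_finsum]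
  refine finsum_congr fun k => ?_
  rw [RingEquiv.coe_toAddEquiv, map_mul, ← polarCoeff_coeffAut hj, map_mul, map_zpow₀, map_zpow₀,
    hσ]

/-- If the `q`-orbits of the points `b i` are disjoint, only finitely many of the discrete
residues of `f` at these orbits are nonzero. -/
theorem finite_qResidue_ne_zero (hj : 1 ≤ j) {ι : Type*} (b : ι → K)
    (hb : ∀ i i' (k k' : ℤ), q ^ k * b i = q ^ k' * b i' → i = i') (f : RatFunc K) :
    {i | qResidue q j (b i) f ≠ 0}.Finite := by
  have h : ∀ i ∈ {i | qResidue q j (b i) f ≠ 0}, ∃ k : ℤ, polarCoeff j (q ^ k * b i) f ≠ 0 := by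
    intro i hi
    by_contra! h
    exact hi (by simp [qResidue, h])
  -- One pole is picked in each orbit with nonzero residue; disjointness of the orbits makes the
  -- choice injective into a finite set.
  choose! k hk using h
  exact Set.Finite.of_finite_image
    ((finite_polarCoeff_ne_zero hj f).subset (Set.image_subset_iff.mpr hk))
    fun i _ i' _ h => hb i i' _ _ h

/-- The discrete residues of a summable rational function satisfy the telescoping relation. -/
theorem qResidue_telescope (hj : 1 ≤ j) (hq0 : q ≠ 0)
    (hq : ∀ n : ℕ, 0 < n → q ^ n ≠ 1) (σ : K ≃+* K) (hσ : σ q = q) {g h : RatFunc K} (hb : b ≠ 0) :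
    qResidue q j (σ b) ((coeffAut σ g - g) + (scaleAut q hq0 h - h)) =
      σ (qResidue q j b g) - qResidue q j (σ b) g := by
  have hb' : σ b ≠ 0 := by simpa using hb
  rw [qResidue_add hj hq0 hq hb', qResidue_sub hj hq0 hq hb', qResidue_sub hj hq0 hq hb',
    qResidue_scaleAut hj, sub_self, add_zero, qResidue_coeffAut hj σ hσ]

end QResidue

/-! ### Constants and monomials as eigenvectors of `q`-shifts -/

section FixedField

variable {F : Type*} [Field F]

theorem finite_range_algHom_apply {K E : Type*} [Field K] [Field E] [Algebra K E] {x : E}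
    (hx : IsAlgebraic K x) : (Set.range fun ρ : E →ₐ[K] E => ρ x).Finite := by
  obtain ⟨p, hp0, hp⟩ := hx
  refine (p.rootSet_finite E).subset ?_
  rintro _ ⟨ρ, rfl⟩
  rw [Polynomial.mem_rootSet]
  exact ⟨hp0, by rw [Polynomial.aeval_algHom_apply, hp, map_zero]⟩

theorem exists_eq_algebraMap_of_isIntegral {K E : Type*} [Field K] [IsAlgClosed K] [Field E]
    [Algebra K E] {x : E} (hx : IsIntegral K x) : ∃ c : K, x = algebraMap K E c := by
  obtain ⟨c, hc⟩ := minpoly.mem_range_of_degree_eq_one K x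
    (IsAlgClosed.degree_eq_one_of_irreducible K (minpoly.irreducible hx))
  exact ⟨c, hc.symm⟩

theorem xvar_ne_zero : xvar F ≠ 0 :=
  (map_ne_zero_iff _ (algebraMap (RatFunc F) (AlgFun F)).injective).mpr RatFunc.X_ne_zero

theorem trdeg_algFun : Algebra.trdeg F (AlgFun F) = 1 := by
  have h : IsTranscendenceBasis F (algebraMap (RatFunc F) (AlgFun F) ∘
      algebraMap (Polynomial F) (RatFunc F) ∘ fun _ : Unit => Polynomial.X) :=
    have := IsFractionRing.comap_isAlgebraic_iff (A := Polynomial F) (K := RatFunc F)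
      (C := RatFunc F) |>.mpr inferInstance
    (IsTranscendenceBasis.polynomial Unit F).algebraMap_comp.algebraMap_comp
  simpa using h.lift_cardinalMk_eq_trdeg.symm

/-- In transcendence degree one, a single transcendental element is already a transcendence basis.
-/
theorem isAlgebraic_of_transcendental_mem {u : AlgFun F} (hu : Transcendental F u)
    (L : IntermediateField F (AlgFun F)) (huL : u ∈ L) : Algebra.IsAlgebraic L (AlgFun F) := by
  have hb : IsTranscendenceBasis F fun _ : Unit => u :=
    AlgebraicIndependent.isTranscendenceBasis_of_lift_trdeg_le_of_finite
      (algebraicIndependent_unique_type_iff.mpr hu) (by simp [trdeg_algFun])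
  have halg := hb.isAlgebraic
  have hle : Algebra.adjoin F (Set.range fun _ : Unit => u) ≤ L.toSubalgebra := by
    rw [Algebra.adjoin_le_iff]
    rintro _ ⟨_, rfl⟩
    exact huL
  let : Algebra (Algebra.adjoin F (Set.range fun _ : Unit => u)) L :=
    (Subalgebra.inclusion hle).toAlgebra
  have : IsScalarTower (Algebra.adjoin F (Set.range fun _ : Unit => u)) L (AlgFun F) :=
    .of_algebraMap_eq fun _ => rfl
  exact Algebra.IsAlgebraic.extendScalars (R := Algebra.adjoin F (Set.range fun _ : Unit => u))
    (Subalgebra.inclusion_injective hle)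

theorem root_xvar_ne_zero {t : ℕ} (ht : 0 < t) {ξ : AlgFun F} (hξ : ξ ^ t = xvar F) : ξ ≠ 0 := by
  rintro rfl
  exact xvar_ne_zero (F := F) (by rw [← hξ, zero_pow ht.ne'])

variable {q : F} {σ : AlgFun F ≃ₐ[F] AlgFun F}

theorem isQShift_pow (hσ : IsQShift q σ) (n : ℕ) : IsQShift (q ^ n) (σ ^ n) := by
  induction n with
  | zero => simp [IsQShift]
  | succ n ih =>
    rw [IsQShift] at *
    rw [pow_succ', AlgEquiv.mul_apply, ih, map_mul, AlgEquiv.commutes, hσ, ← mul_assoc, ← map_mul,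
      pow_succ]

variable [IsAlgClosed F]

/-- The fixed points of a `q`-shift are constant when `q` is not a root of unity. -/
theorem exists_eq_algebraMap_of_fixed (hq0 : q ≠ 0) (hq : ∀ n : ℕ, 0 < n → q ^ n ≠ 1)
    (hσ : IsQShift q σ) {u : AlgFun F} (hu : σ u = u) : ∃ c : F, u = algebraMap F (AlgFun F) c := by
  by_cases hF : Transcendental F u
  · exfalso
    -- If `u` were transcendental, `x` would be algebraic over the fixed field `L`. But the powers
    -- of `σ` are `L`-automorphisms sending `x` to infinitely many conjugates `q ^ n * x`.
    let L : IntermediateField F (AlgFun F) := IntermediateField.fixedField (Subgroup.zpowers σ)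
    have huL : u ∈ L := by
      rintro ⟨_, n, rfl⟩
      exact (MulAction.mem_stabilizer_iff (G := AlgFun F ≃ₐ[F] AlgFun F)).mp
        (zpow_mem (show σ ∈ MulAction.stabilizer (AlgFun F ≃ₐ[F] AlgFun F) u from hu) n)
    have hfin := finite_range_algHom_apply
      ((isAlgebraic_of_transcendental_mem hF L huL).isAlgebraic (xvar F))
    have hmem : ∀ n : ℕ, algebraMap F (AlgFun F) (q ^ n) * xvar F ∈
        Set.range fun ρ : AlgFun F →ₐ[L] AlgFun F => ρ (xvar F) := fun n =>
      ⟨{ ((σ ^ n : AlgFun F ≃ₐ[F] AlgFun F) : AlgFun F →+* AlgFun F) with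
          commutes' := fun a => a.2 ⟨σ ^ n, Subgroup.npow_mem_zpowers σ n⟩ }, isQShift_pow hσ n⟩
    refine Set.infinite_of_injective_forall_mem ?_ hmem hfin
    intro a b hab
    have := (algebraMap F (AlgFun F)).injective (mul_right_cancel₀ xvar_ne_zero hab)
    exact_mod_cast zpow_injective_of_pow_ne_one hq0 hq
      (a₁ := (a : ℤ)) (a₂ := (b : ℤ)) (by simpa using this)
  · rw [Transcendental, not_not] at hF
    exact exists_eq_algebraMap_of_isIntegral hF.isIntegral

/-- The ratio `w = σ ξ / ξ` satisfies `w ^ t = q`, so it lies in `F` and is fixed by `σ`. Iterating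
`t` times gives `w ^ t = q`, whichever extension `σ` and root `ξ` are used. -/
theorem apply_root_xvar {t : ℕ} (ht : 0 < t) (hσ : IsQShift q σ) {ξ : AlgFun F}
    (hξ : ξ ^ t = xvar F) : (σ ^ t) ξ = algebraMap F (AlgFun F) q * ξ := by
  have hξ0 : ξ ≠ 0 := root_xvar_ne_zero ht hξ
  have hw : (σ ξ / ξ) ^ t = algebraMap F (AlgFun F) q := by
    rw [div_pow, ← map_pow, hξ, hσ, mul_div_cancel_right₀ _ xvar_ne_zero]
  obtain ⟨w, hσξ⟩ := exists_eq_algebraMap_of_isIntegral (K := F)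
    (IsIntegral.of_pow ht (hw ▸ isIntegral_algebraMap))
  have hpow : ∀ n : ℕ, (σ ^ n) ξ = algebraMap F (AlgFun F) (w ^ n) * ξ := by
    intro n
    induction n with
    | zero => simp
    | succ n ih =>
      rw [pow_succ', AlgEquiv.mul_apply, ih, map_mul, AlgEquiv.commutes,
        (div_eq_iff hξ0).mp hσξ, ← mul_assoc, ← map_mul, pow_succ]
  rw [hpow, map_pow, ← hσξ, hw]

/-- An element scaled by a power of `q` under a power of a `q`-shift is a monomial. -/
theorem exists_eq_monomial (hq0 : q ≠ 0) (hq : ∀ n : ℕ, 0 < n → q ^ n ≠ 1)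
    (hσ : IsQShift q σ) {t : ℕ} (ht : 0 < t) {s : ℤ} {b : AlgFun F}
    (hb : (σ ^ t) b = algebraMap F (AlgFun F) (q ^ s) * b) :
    ∃ (c : F) (ξ : AlgFun F), ξ ^ t = xvar F ∧ b = algebraMap F (AlgFun F) c * ξ ^ s := by
  obtain ⟨ξ, hξ⟩ := IsAlgClosed.exists_pow_nat_eq (xvar F) ht
  have hξ0 : ξ ≠ 0 := root_xvar_ne_zero ht hξ
  have hq0' : algebraMap F (AlgFun F) (q ^ s) ≠ 0 :=
    (map_ne_zero_iff _ (algebraMap F (AlgFun F)).injective).mpr (zpow_ne_zero s hq0)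
  have h := apply_root_xvar ht hσ hξ
  obtain ⟨c, hc⟩ := exists_eq_algebraMap_of_fixed (pow_ne_zero t hq0)
    (fun n hn => by rw [← pow_mul]; exact hq _ (Nat.mul_pos ht hn))
    (isQShift_pow hσ t) (u := b / ξ ^ s) (by
      rw [map_div₀, hb, map_zpow₀ (σ ^ t), h, mul_zpow, ← map_zpow₀, mul_div_mul_left _ _ hq0'])
  exact ⟨c, ξ, hξ, by rw [← hc, div_mul_cancel₀ _ (zpow_ne_zero s hξ0)]⟩

end FixedField

/-! ### Descent by the normalized trace -/

section Descent

open Polynomial in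
/-- The normalized trace to an intermediate field is compatible with automorphisms that preserve
this field. -/
theorem normalizedTrace_comm {F E : Type*} [Field F] [Field E] [Algebra F E] [CharZero F]
    (L : IntermediateField F E) [Algebra.IsIntegral L E] (σ : E ≃ₐ[F] E)
    (hσ : ∀ a, σ a ∈ L ↔ a ∈ L) (a : E) :
    (Algebra.normalizedTrace L E (σ a) : E) = σ (Algebra.normalizedTrace L E a) := by
  let ρ : L ≃+* L :=
    { toFun := fun a => ⟨σ a, (hσ a).mpr a.2⟩
      invFun := fun a => ⟨σ.symm a, (hσ _).mp (by simp)⟩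
      left_inv := fun a => by simp
      right_inv := fun a => by simp
      map_mul' := fun a b => by ext; simp
      map_add' := fun a b => by ext; simp }
  have hmin : minpoly L (σ a) = (minpoly L a).map (ρ : L →+* L) := by
    refine (minpoly.eq_of_irreducible_of_monic ?_ ?_ ?_).symm
    · exact (MulEquiv.irreducible_iff (mapEquiv ρ)).mpr
        (minpoly.irreducible (Algebra.IsIntegral.isIntegral a))
    · have h := congrArg σ (minpoly.aeval L a)
      rw [aeval_def, ← AlgEquiv.coe_ringEquiv, ← RingEquiv.coe_toRingHom, hom_eval₂, map_zero] at h
      rw [aeval_def, eval₂_map]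
      exact h
    · exact (minpoly.monic (Algebra.IsIntegral.isIntegral a)).map _
  have h : Algebra.normalizedTrace L E (σ a) = ρ (Algebra.normalizedTrace L E a) := by
    rw [Algebra.normalizedTrace_minpoly, Algebra.normalizedTrace_minpoly, hmin, nextCoeff_map
      (RingHom.injective _), natDegree_map]
    simp
  rw [h]
  rfl

/-- The normalized trace is `L`-linear, is the identity on `L` and commutes with `σ`, so it can be
applied to the whole equation. It does not need `E` to be finite over `L`. -/
theorem exists_mem_of_twisted_difference {F E : Type*} [Field F] [Field E] [Algebra F E]
    [CharZero F] (L : IntermediateField F E) [Algebra.IsIntegral L E] (σ : E ≃ₐ[F] E)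
    (hσ : ∀ a, σ a ∈ L ↔ a ∈ L) (c : F) {α γ : E} (hα : α ∈ L)
    (h : α = algebraMap F E c * σ γ - γ) :
    ∃ γ' ∈ L, α = algebraMap F E c * σ γ' - γ' := by
  refine ⟨Algebra.normalizedTrace L E γ, SetLike.coe_mem _, ?_⟩
  rw [← normalizedTrace_comm L σ hσ]
  have key : algebraMap L E (⟨α, hα⟩ : L) = algebraMap F L c • σ γ - γ := by
    rw [Algebra.smul_def, ← IsScalarTower.algebraMap_apply]
    exact h
  have h' := congrArg (Algebra.normalizedTrace L E) key
  rw [Algebra.normalizedTrace_algebraMap_apply_eq_self, map_sub, map_smul] at h'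
  exact congrArg (algebraMap L E) h'

end Descent

/-! ### The field `F(x^{1/t})` -/

section Root

variable {F : Type*} [Field F] {t : ℕ} {ξ : AlgFun F}

theorem algebraMap_mem_adjoin_root (hξ : ξ ^ t = xvar F) (r : RatFunc F) :
    algebraMap (RatFunc F) (AlgFun F) r ∈ IntermediateField.adjoin F {ξ} := by
  have hx : xvar F ∈ IntermediateField.adjoin F {ξ} := by
    rw [← hξ]
    exact pow_mem (IntermediateField.mem_adjoin_simple_self F ξ) t
  have hp : ∀ p : Polynomial F, algebraMap (RatFunc F) (AlgFun F) (algebraMap _ _ p) ∈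
      IntermediateField.adjoin F {ξ} := by
    intro p
    induction p using Polynomial.induction_on' with
    | add p p' h h' => simpa only [map_add] using add_mem h h'
    | monomial n a =>
      rw [RatFunc.algebraMap_monomial, map_mul, map_pow]
      refine mul_mem ?_ (pow_mem hx n)
      rw [← RatFunc.algebraMap_eq_C, ← IsScalarTower.algebraMap_apply]
      exact IntermediateField.algebraMap_mem _ a
  rw [← RatFunc.num_div_denom r, map_div₀]
  exact div_mem (hp _) (hp _)

theorem isIntegral_adjoin_root (hξ : ξ ^ t = xvar F) :
    Algebra.IsIntegral (IntermediateField.adjoin F {ξ}) (AlgFun F) := by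
  have hr := algebraMap_mem_adjoin_root hξ
  let : Algebra (RatFunc F) (IntermediateField.adjoin F {ξ}) :=
    ((algebraMap (RatFunc F) (AlgFun F)).codRestrict _ hr).toAlgebra
  have : IsScalarTower (RatFunc F) (IntermediateField.adjoin F {ξ}) (AlgFun F) :=
    .of_algebraMap_eq fun _ => rfl
  exact Algebra.IsIntegral.tower_top (R := RatFunc F)

theorem mem_adjoin_root_of_mem (hξ : ξ ^ t = xvar F) {c : F} {s : ℤ} {b a : AlgFun F}
    (hb : b = algebraMap F (AlgFun F) c * ξ ^ s)
    (ha : a ∈ IntermediateField.adjoin (RatFunc F) {b}) : a ∈ IntermediateField.adjoin F {ξ} := by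
  let L : IntermediateField (RatFunc F) (AlgFun F) :=
    (IntermediateField.adjoin F {ξ}).toSubfield.toIntermediateField (algebraMap_mem_adjoin_root hξ)
  have hle : IntermediateField.adjoin (RatFunc F) {b} ≤ L := by
    rw [IntermediateField.adjoin_simple_le_iff, hb]
    exact mul_mem (IntermediateField.algebraMap_mem (IntermediateField.adjoin F {ξ}) c)
      (zpow_mem (IntermediateField.mem_adjoin_simple_self F ξ) s)
  exact hle ha

theorem apply_mem_adjoin_root_iff [IsAlgClosed F] {q : F} {σ : AlgFun F ≃ₐ[F] AlgFun F}
    (hq0 : q ≠ 0) (ht : 0 < t) (hσ : IsQShift q σ) (hξ : ξ ^ t = xvar F) (a : AlgFun F) :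
    (σ ^ t) a ∈ IntermediateField.adjoin F {ξ} ↔ a ∈ IntermediateField.adjoin F {ξ} := by
  have hmap : (IntermediateField.adjoin F {ξ}).map
      ((σ ^ t : AlgFun F ≃ₐ[F] AlgFun F) : AlgFun F →ₐ[F] AlgFun F) =
      IntermediateField.adjoin F {ξ} := by
    rw [IntermediateField.adjoin_map, Set.image_singleton, AlgEquiv.coe_toAlgHom,
      apply_root_xvar ht hσ hξ]
    refine le_antisymm ?_ ?_ <;> rw [IntermediateField.adjoin_simple_le_iff]
    · exact mul_mem (IntermediateField.algebraMap_mem _ q)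
        (IntermediateField.mem_adjoin_simple_self F ξ)
    · have h := mul_mem (IntermediateField.algebraMap_mem _ q⁻¹)
        (IntermediateField.mem_adjoin_simple_self F (algebraMap F (AlgFun F) q * ξ))
      rwa [← mul_assoc, ← map_mul, inv_mul_cancel₀ hq0, map_one, one_mul] at h
  conv_lhs => rw [← hmap]
  constructor
  · rintro ⟨a', ha', h⟩
    rwa [← (σ ^ t).injective h]
  · exact fun h => ⟨a, h, rfl⟩

end Root

/-! ### Necessity: the recursion for the residues of `g` -/

section Necessity

variable {F E : Type*} [Field F] [Field E] [Algebra F E]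
  {q : F} {τ : E ≃ₐ[F] E} {j : ℕ} {b : E}

theorem zpow_apply_ne_zero (hb : b ≠ 0) (n : ℤ) : (τ ^ n) b ≠ 0 := by simpa using hb

/-- The points `τ ^ n b` lie in distinct `q`-orbits if no positive power of `τ` maps `b` into
its `q`-orbit. -/
theorem eq_of_mem_qOrbit (hq0 : q ≠ 0)
    (h : ¬ ∃ t : ℕ, 0 < t ∧ ∃ s : ℤ, (τ ^ t) b = algebraMap F E (q ^ s) * b) {n n' k k' : ℤ}
    (hn : algebraMap F E q ^ k * (τ ^ n) b = algebraMap F E q ^ k' * (τ ^ n') b) : n = n' := by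
  have hQ : algebraMap F E q ≠ 0 := (map_ne_zero_iff _ (algebraMap F E).injective).mpr hq0
  have key : ∀ n n' k k' : ℤ, n < n' →
      algebraMap F E q ^ k * (τ ^ n) b ≠ algebraMap F E q ^ k' * (τ ^ n') b := by
    intro n n' k k' hlt hn
    obtain ⟨t, ht⟩ := Int.eq_ofNat_of_zero_le (sub_nonneg.mpr hlt.le)
    refine h ⟨t, by omega, k - k', (τ ^ n).injective ?_⟩
    rw [← AlgEquiv.mul_apply, ← zpow_natCast τ t, ← ht, ← zpow_add, add_sub_cancel, map_mul,
      AlgEquiv.commutes, map_zpow₀, zpow_sub₀ hQ, div_mul_eq_mul_div, hn,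
      mul_div_cancel_left₀ _ (zpow_ne_zero _ hQ)]
  rcases lt_trichotomy n n' with h' | h' | h'
  · exact absurd hn (key _ _ _ _ h')
  · exact h'
  · exact absurd hn.symm (key _ _ _ _ h')

variable [IsAlgClosed E]

/-- If the discrete residues of a summable `f` vanish at the orbits of all `τ ^ n b` other than
the `q`-orbit of `b`, then either the residue at `b` vanishes, or some positive power of `τ`
preserves the `q`-orbit of `b` and the residue at `b` is a twisted difference. -/
theorem exists_twisted_difference_of_isSummable (hj : 1 ≤ j) (hq0 : q ≠ 0)
    (hq : ∀ n : ℕ, 0 < n → q ^ n ≠ 1) (hQ : algebraMap F E q ≠ 0) (hb : b ≠ 0) {f : RatFunc E}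
    (hf : IsSummable (coeffAut τ.toRingEquiv) (scaleAut (algebraMap F E q) hQ) f)
    (hres : ∀ n : ℤ, (∀ k : ℤ, algebraMap F E q ^ k * (τ ^ n) b ≠ b) →
      qResidue (algebraMap F E q) j ((τ ^ n) b) f = 0)
    (ha : qResidue (algebraMap F E q) j b f ≠ 0) :
    ∃ (t : ℕ) (s : ℤ) (γ : E), 0 < t ∧ (τ ^ t) b = algebraMap F E (q ^ s) * b ∧
      qResidue (algebraMap F E q) j b f =
        algebraMap F E (q ^ (-((j : ℤ) * s))) * (τ ^ t) γ - γ := by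
  classical
  obtain ⟨g, h, hgh⟩ := hf
  have hq' : ∀ n : ℕ, 0 < n → algebraMap F E q ^ n ≠ 1 := fun n hn h1 => hq n hn <|
    (algebraMap F E).injective (by rw [map_pow, h1, map_one])
  set Q := algebraMap F E q with hQdef
  set R : ℤ → E := fun n => qResidue Q j ((τ ^ n) b) g with hR
  have tele : ∀ n : ℤ, qResidue Q j ((τ ^ (n + 1)) b) f = τ (R n) - R (n + 1) := by
    intro n
    have hn : (τ ^ (n + 1)) b = τ.toRingEquiv ((τ ^ n) b) := by
      rw [add_comm, zpow_one_add]
      rfl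
    have := qResidue_telescope hj hQ hq' τ.toRingEquiv (τ.commutes q) (g := g) (h := h)
      (zpow_apply_ne_zero (τ := τ) hb n)
    rw [← hgh, ← hn] at this
    exact this
  -- Until the first return to the `q`-orbit of `b`, the residues of `f` vanish and the telescoping
  -- relation reads `R (n + 1) = τ (R n)`.
  have step : ∀ m : ℕ, (∀ n : ℕ, 0 < n → n ≤ m → ∀ k : ℤ, Q ^ k * (τ ^ (n : ℤ)) b ≠ b) →
      R m = (τ ^ m) (R 0) := by
    intro m
    induction m with
    | zero => simp
    | succ m ih =>
      intro hm
      have h1 := tele m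
      rw [← Nat.cast_succ, hres _ (hm (m + 1) m.succ_pos le_rfl),
        ih fun n hn hnm => hm n hn (hnm.trans m.le_succ)] at h1
      rw [pow_succ', AlgEquiv.mul_apply]
      exact (sub_eq_zero.mp h1.symm).symm
  have orbit : ∀ (n : ℕ) (k : ℤ), Q ^ k * (τ ^ (n : ℤ)) b = b →
      (τ ^ n) b = algebraMap F E (q ^ (-k)) * b := by
    intro n k hk
    rw [map_zpow₀, zpow_neg, eq_inv_mul_iff_mul_eq₀ (zpow_ne_zero _ hQ)]
    simpa using hk
  by_cases hper : ∃ t : ℕ, 0 < t ∧ ∃ s : ℤ, (τ ^ t) b = algebraMap F E (q ^ s) * b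
  -- Minimality of `t` lets `step` run up to `m = t - 1`. The relation at `t` then becomes `Q^(js) *
  -- Res_b f = τ^t (R 0) - Q^(js) * R 0`.
  · obtain ⟨ht, s, hs⟩ := Nat.find_spec hper
    set t := Nat.find hper with htdef
    obtain ⟨m, hm⟩ : ∃ m, t = m + 1 := ⟨t - 1, by omega⟩
    have hRm := step m fun n hn hnm k hk =>
      Nat.find_min hper (m := n) (by omega) ⟨hn, -k, orbit n k hk⟩
    have h1 := tele m
    have hs' : (τ ^ ((m : ℤ) + 1)) b = Q ^ s * b := by
      rw [← Nat.cast_succ, zpow_natCast, Nat.succ_eq_add_one, ← hm, hs, map_zpow₀]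
    have hRt : R (m + 1) = Q ^ (j * s : ℤ) * R 0 := by
      simp only [hR, hs', qResidue_zpow_mul hQ, zpow_zero, AlgEquiv.one_apply]
    rw [hRt, hs', qResidue_zpow_mul hQ, hRm, ← AlgEquiv.mul_apply, ← pow_succ', ← hm] at h1
    refine ⟨t, s, R 0, ht, hs, ?_⟩
    have hne : Q ^ (j * s : ℤ) ≠ 0 := zpow_ne_zero _ hQ
    rw [map_zpow₀, zpow_neg]
    refine mul_left_cancel₀ hne ?_
    rw [h1, mul_sub, mul_inv_cancel_left₀ hne]
  · exfalso
    have hfin := finite_qResidue_ne_zero (q := Q) hj (fun n : ℤ => (τ ^ n) b)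
      (fun n n' k k' hn => eq_of_mem_qOrbit hq0 hper hn) g
    have hfree : ∀ n : ℤ, n ≠ 0 → ∀ k : ℤ, Q ^ k * (τ ^ n) b ≠ b := fun n hn k hk =>
      hn (eq_of_mem_qOrbit hq0 hper (k := k) (k' := 0) (n' := 0) (by simpa using hk))
    have hR0 : R 0 = 0 := by
      by_contra hne
      refine Set.infinite_of_injective_forall_mem (f := fun n : ℕ => (n : ℤ))
        Nat.cast_injective (fun n => ?_) hfin
      have : R n ≠ 0 := by
        rw [step n fun n hn _ => hfree n (by omega)]
        exact (map_ne_zero_iff _ (τ ^ n).injective).mpr hne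
      exact this
    -- Since `R 0 = 0`, the residue of `f` at `b` is `τ (R (-1))`, so `R (-1) ≠ 0`; the recursion
    -- then propagates nonvanishing backwards.
    have hneg : ∀ n : ℕ, R (-(n + 1 : ℕ)) ≠ 0 := by
      intro n
      induction n with
      | zero =>
        have h1 := tele (-1)
        rw [neg_add_cancel, hR0, sub_zero, zpow_zero, AlgEquiv.one_apply] at h1
        intro h0
        exact ha (by rw [h1, ← map_zero τ]; exact congrArg τ h0)
      | succ n ih =>
        have h1 := tele (-(n + 1 + 1 : ℕ))
        rw [show (-(n + 1 + 1 : ℕ) + 1 : ℤ) = -(n + 1 : ℕ) by push_cast; ring,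
          hres _ (hfree _ (by omega))] at h1
        intro h0
        rw [h0, map_zero, zero_sub, eq_comm, neg_eq_zero] at h1
        exact ih h1
    exact Set.infinite_of_injective_forall_mem (f := fun n : ℕ => (-(n + 1 : ℕ) : ℤ))
      (fun n n' hn => by simpa using hn) hneg hfin

end Necessity

/-! ### Sufficiency: moving poles modulo summable elements -/

section Sufficiency

theorem IsSummable.zero {K : Type*} [Field K] {φ ψ : K ≃+* K} : IsSummable φ ψ 0 :=
  ⟨0, 0, by simp⟩

theorem IsSummable.add {K : Type*} [Field K] {φ ψ : K ≃+* K} {u v : K} (hu : IsSummable φ ψ u)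
    (hv : IsSummable φ ψ v) : IsSummable φ ψ (u + v) := by
  obtain ⟨g, h, rfl⟩ := hu
  obtain ⟨g', h', rfl⟩ := hv
  exact ⟨g + g', h + h', by simp only [map_add]; ring⟩

theorem IsSummable.neg {K : Type*} [Field K] {φ ψ : K ≃+* K} {u : K} (hu : IsSummable φ ψ u) :
    IsSummable φ ψ (-u) := by
  obtain ⟨g, h, rfl⟩ := hu
  exact ⟨-g, -h, by simp only [map_neg]; ring⟩

theorem IsSummable.sub_trans {K : Type*} [Field K] {φ ψ : K ≃+* K} {u v w : K}
    (huv : IsSummable φ ψ (u - v)) (hvw : IsSummable φ ψ (v - w)) : IsSummable φ ψ (u - w) := by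
  simpa using huv.add hvw

theorem isSummable_left_sub {K : Type*} [Field K] (φ ψ : K ≃+* K) (g : K) :
    IsSummable φ ψ (φ g - g) :=
  ⟨g, 0, by simp⟩

theorem isSummable_right_sub {K : Type*} [Field K] (φ ψ : K ≃+* K) (h : K) :
    IsSummable φ ψ (ψ h - h) :=
  ⟨0, h, by simp⟩

theorem IsSummable.sum {K : Type*} [Field K] {φ ψ : K ≃+* K} {ι : Type*} (s : Finset ι)
    {u : ι → K} (hu : ∀ i, IsSummable φ ψ (u i)) : IsSummable φ ψ (∑ i ∈ s, u i) :=
  Finset.sum_induction _ _ (fun _ _ => IsSummable.add) IsSummable.zero fun i _ => hu i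

variable {F E : Type*} [Field F] [Field E] [Algebra F E] {q : F} {τ : E ≃ₐ[F] E} {j : ℕ}

theorem coeffAut_pole (σ : E ≃+* E) (a b : E) (n : ℕ) :
    coeffAut σ (RatFunc.C a / (RatFunc.X - RatFunc.C b) ^ n) =
      RatFunc.C (σ a) / (RatFunc.X - RatFunc.C (σ b)) ^ n := by
  rw [map_div₀, map_pow, map_sub, coeffAut_C, coeffAut_C, coeffAut_X]

theorem isSummable_coeffAut_pow_pole (ψ : RatFunc E ≃+* RatFunc E) (a b : E) (t : ℕ) :
    IsSummable (coeffAut τ.toRingEquiv) ψ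
      (RatFunc.C ((τ ^ t) a) / (RatFunc.X - RatFunc.C ((τ ^ t) b)) ^ j -
        RatFunc.C a / (RatFunc.X - RatFunc.C b) ^ j) := by
  induction t with
  | zero => simpa using IsSummable.zero
  | succ t ih =>
    have h := isSummable_left_sub (coeffAut τ.toRingEquiv) ψ
      (RatFunc.C ((τ ^ t) a) / (RatFunc.X - RatFunc.C ((τ ^ t) b)) ^ j)
    rw [coeffAut_pole] at h
    rw [pow_succ']
    exact h.sub_trans ih

theorem isSummable_scaleAut_zpow_pole {Q : E} (hQ : Q ≠ 0) (φ : RatFunc E ≃+* RatFunc E) (a b : E)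
    (s : ℤ) : IsSummable φ (scaleAut Q hQ)
      (RatFunc.C (Q ^ (-(j * s : ℤ)) * a) / (RatFunc.X - RatFunc.C (Q ^ (-s) * b)) ^ j -
        RatFunc.C a / (RatFunc.X - RatFunc.C b) ^ j) := by
  have key : ∀ s : ℤ, scaleAut Q hQ
      (RatFunc.C (Q ^ (-(j * s : ℤ)) * a) / (RatFunc.X - RatFunc.C (Q ^ (-s) * b)) ^ j) =
      RatFunc.C (Q ^ (-(j * (s + 1) : ℤ)) * a) /
        (RatFunc.X - RatFunc.C (Q ^ (-(s + 1)) * b)) ^ j := by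
    intro s
    rw [scaleAut_pole, ← mul_assoc, ← mul_assoc, ← zpow_natCast, ← zpow_neg, ← zpow_neg_one,
      ← zpow_add₀ hQ, ← zpow_add₀ hQ, show -(j : ℤ) + -(j * s) = -(j * (s + 1)) by ring,
      neg_add_rev s 1]
  induction s using Int.induction_on with
  | zero => simpa using IsSummable.zero
  | succ n ih =>
    have h := isSummable_right_sub φ (scaleAut Q hQ) (RatFunc.C (Q ^ (-(j * n : ℤ)) * a) /
      (RatFunc.X - RatFunc.C (Q ^ (-n : ℤ) * b)) ^ j)
    rw [key] at h
    exact h.sub_trans ih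
  | pred n ih =>
    have h := (isSummable_right_sub φ (scaleAut Q hQ) (RatFunc.C (Q ^ (-(j * (-n - 1) : ℤ)) * a) /
      (RatFunc.X - RatFunc.C (Q ^ (-(-n - 1) : ℤ) * b)) ^ j)).neg
    rw [key, sub_add_cancel, neg_sub] at h
    exact h.sub_trans ih

/-- Start from `γ / (y - b)^j`: applying `τ_x` `t` times and then scaling back by `s` steps returns
the pole to `b` with coefficient `Q^(-js) τ^t γ`. -/
theorem isSummable_pole_of_twisted_difference (hQ : algebraMap F E q ≠ 0) {a b γ : E} {s : ℤ}
    {t : ℕ} (hb : (τ ^ t) b = algebraMap F E (q ^ s) * b)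
    (ha : a = algebraMap F E (q ^ (-((j : ℤ) * s))) * (τ ^ t) γ - γ) :
    IsSummable (coeffAut τ.toRingEquiv) (scaleAut (algebraMap F E q) hQ)
      (RatFunc.C a / (RatFunc.X - RatFunc.C b) ^ j) := by
  have h := (isSummable_scaleAut_zpow_pole hQ (coeffAut τ.toRingEquiv) (j := j)
    ((τ ^ t) γ) ((τ ^ t) b) s).sub_trans (isSummable_coeffAut_pow_pole _ γ b t)
  have hb' : algebraMap F E q ^ (-s) * (τ ^ t) b = b := by
    rw [hb, map_zpow₀, zpow_neg, inv_mul_cancel_left₀ (zpow_ne_zero _ hQ)]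
  rwa [hb', ← sub_div, ← map_sub, ← map_zpow₀, ← ha] at h

end Sufficiency

end QSummability

end

theorem theorem3p9 {F : Type*} [Field F] [IsAlgClosed F] [CharZero F]
    (q : F) (hq0 : q ≠ 0) (hq : ∀ n : ℕ, 0 < n → q ^ n ≠ 1)
    (τ : AlgFun F ≃ₐ[F] AlgFun F) (hτ : IsQShift q τ)
    (m j : ℕ) (hj : 1 ≤ j) (α β : Fin m → AlgFun F)
    (hα : ∀ i, α i ≠ 0) (hβ : ∀ i, β i ≠ 0)
    (hcond : ∀ i i' : Fin m, i < i' → ∀ n k : ℤ,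
      β i / (τ ^ n) (β i') ≠ algebraMap F (AlgFun F) (q ^ k))
    (f : RatFunc (AlgFun F))
    (hf : f = ∑ i, RatFunc.C (α i) / (RatFunc.X - RatFunc.C (β i)) ^ j) :
    -- the criterion for arbitrary algebraic coefficients
    (IsSummable (tauX τ) (tauY q hq0) f ↔
      ∀ i, ∃ (s : ℤ) (t : ℕ) (c : F) (ξ γ : AlgFun F),
        0 < t ∧ ξ ^ t = xvar F ∧
        β i = algebraMap F (AlgFun F) c * ξ ^ s ∧
        α i = algebraMap F (AlgFun F) (q ^ (-((j : ℤ) * s))) * (τ ^ t) γ - γ) ∧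
    -- if each `α i` lies in `F(x)(β i)`, the same criterion with `γ` in `F(x^{1/t})`
    ((∀ i, α i ∈ IntermediateField.adjoin (RatFunc F) {β i}) →
      (IsSummable (tauX τ) (tauY q hq0) f ↔
        ∀ i, ∃ (s : ℤ) (t : ℕ) (c : F) (ξ γ : AlgFun F),
          0 < t ∧ ξ ^ t = xvar F ∧
          β i = algebraMap F (AlgFun F) c * ξ ^ s ∧
          γ ∈ IntermediateField.adjoin F {ξ} ∧
          α i = algebraMap F (AlgFun F) (q ^ (-((j : ℤ) * s))) * (τ ^ t) γ - γ)) := by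
  have hQ : algebraMap F (AlgFun F) q ≠ 0 :=
    (map_ne_zero_iff _ (algebraMap F (AlgFun F)).injective).mpr hq0
  have hq' : ∀ n : ℕ, 0 < n → algebraMap F (AlgFun F) q ^ n ≠ 1 := fun n hn h1 => hq n hn <|
    (algebraMap F (AlgFun F)).injective (by rw [map_pow, h1, map_one])
  -- The hypothesis covers only `i < i'`; the other order follows by applying `τ ^ (-n)`.
  have horbit : ∀ i i' : Fin m, i' ≠ i → ∀ n k : ℤ,
      algebraMap F (AlgFun F) q ^ k * (τ ^ n) (β i) ≠ β i' := by
    intro i i' hne n k h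
    rcases lt_or_gt_of_ne hne with hlt | hlt
    · refine hcond i' i hlt n k ?_
      rw [← h, mul_div_cancel_right₀ _ (zpow_apply_ne_zero (hβ i) n), map_zpow₀]
    · refine hcond i i' hlt (-n) (-k) ?_
      rw [← h, map_mul, ← map_zpow₀, AlgEquiv.commutes, ← AlgEquiv.mul_apply, ← zpow_add,
        neg_add_cancel, zpow_zero, AlgEquiv.one_apply, div_mul_cancel_right₀ (hβ i), zpow_neg,
        map_inv₀]
  have hnec : IsSummable (tauX τ) (tauY q hq0) f →
      ∀ i, ∃ (s : ℤ) (t : ℕ) (c : F) (ξ γ : AlgFun F), 0 < t ∧ ξ ^ t = xvar F ∧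
        β i = algebraMap F (AlgFun F) c * ξ ^ s ∧
        α i = algebraMap F (AlgFun F) (q ^ (-((j : ℤ) * s))) * (τ ^ t) γ - γ := by
    intro hsum i
    have hres : qResidue (algebraMap F (AlgFun F) q) j (β i) f = α i := by
      rw [hf, qResidue_sum hj hQ hq' (hβ i), Finset.sum_eq_single i,
        qResidue_pole_self hj hQ hq' (hβ i)]
      · intro i' _ hne
        exact qResidue_pole_of_ne hj fun k => by simpa using horbit i i' hne 0 k
      · simp
    obtain ⟨t, s, γ, ht, hb, ha⟩ := exists_twisted_difference_of_isSummable hj hq0 hq hQ (hβ i)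
      hsum (fun n hn => by
        rw [hf, qResidue_sum hj hQ hq' (zpow_apply_ne_zero (hβ i) n)]
        refine Finset.sum_eq_zero fun i' _ => qResidue_pole_of_ne hj fun k => ?_
        -- The orbit of `β i` may return to itself, which is why `hn` is needed for the summand `i`.
        by_cases h : i' = i
        · exact h ▸ hn k
        · exact horbit i i' h n k) (hres ▸ hα i)
    obtain ⟨c, ξ, hξ, hc⟩ := exists_eq_monomial hq0 hq hτ ht hb
    exact ⟨s, t, c, ξ, γ, ht, hξ, hc, hres ▸ ha⟩
  have hsuff : (∀ i, ∃ (s : ℤ) (t : ℕ) (c : F) (ξ γ : AlgFun F), 0 < t ∧ ξ ^ t = xvar F ∧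
        β i = algebraMap F (AlgFun F) c * ξ ^ s ∧
        α i = algebraMap F (AlgFun F) (q ^ (-((j : ℤ) * s))) * (τ ^ t) γ - γ) →
      IsSummable (tauX τ) (tauY q hq0) f := by
    intro h
    rw [hf]
    refine IsSummable.sum _ fun i => ?_
    obtain ⟨s, t, c, ξ, γ, ht, hξ, hb, ha⟩ := h i
    refine isSummable_pole_of_twisted_difference hQ ?_ ha
    rw [hb, map_mul, AlgEquiv.commutes, map_zpow₀ (τ ^ t), apply_root_xvar ht hτ hξ, mul_zpow,
      ← map_zpow₀, mul_left_comm]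
  refine ⟨⟨hnec, hsuff⟩, fun hmem => ⟨fun hsum i => ?_, fun h => hsuff fun i => ?_⟩⟩
  · obtain ⟨s, t, c, ξ, γ, ht, hξ, hb, ha⟩ := hnec hsum i
    have := isIntegral_adjoin_root hξ
    -- As `β i` is a monomial in `ξ`, `F(x)(β i)` lies in `F(ξ)`, so `α i` is in the field to which
    -- the trace descends.
    obtain ⟨γ', hγ', ha'⟩ := exists_mem_of_twisted_difference (IntermediateField.adjoin F {ξ})
      (τ ^ t) (apply_mem_adjoin_root_iff hq0 ht hτ hξ) _
      (mem_adjoin_root_of_mem hξ hb (hmem i)) ha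
    exact ⟨s, t, c, ξ, γ', ht, hξ, hb, hγ', ha'⟩
  · obtain ⟨s, t, c, ξ, γ, ht, hξ, hb, -, ha⟩ := h i
    exact ⟨s, t, c, ξ, γ, ht, hξ, hb, ha⟩
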